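/- Let $\mathcal H,\mathcal F,\mathcal Y$ be real Hilbert spaces, let $L:\mathscr D(L)\subset\mathcal H\to\mathcal F$ be a closed densely defined linear operator and let $H:\mathcal H\to\mathcal Y$ be a bounded linear operator. Let $Q_1$ on $\mathcal F$ and $Q_2$ on $\mathcal Y$ be bounded self-adjoint operators that are positive definite, i.e. $(Q_ix,x)\ge a_i\|x\|^2$ for all $x$, with some $a_i>0$. For $\ell\in\mathcal H$, $u\in\mathcal Y$ and $c\in\mathbb R$ consider the worst mean squared error $$\sigma(\ell,u,c)=\sup_{\varphi,\eta} M\bigl((\ell,\varphi)-(u,y)-c\bigr)^2,\qquad y=H\varphi+\eta,$$ where $M$ denotes expectation, $\varphi$ ranges over all $\varphi\in\mathscr D(L)$ with $(Q_1L\varphi,L\varphi)\le1$, and $\eta$ ranges over all square integrable random elements of $\mathcal Y$ with $M\eta=0$ and $M(Q_2\eta,\eta)\le1$. The minimax a priori error is $\hat\sigma(\ell)=\bigl(\inf_{u,c}\sigma(\ell,u,c)\bigr)^{1/2}\in[0,\infty]$, and an affine estimate $(u,y)+c$ is called a minimax a priori estimate if it attains this infimum. Suppose that one of the following two assumptions holds: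 1. the sets $R(L)$ and $H(N(L))$ are closed; 2. the set $\{(Lx,Hx):x\in\mathscr D(L)\}$ is closed in $\mathcal F\times\mathcal Y$. Here $R$ and $N$ denote the range and the kernel. Then $\hat\sigma(\ell)<\infty$ if and only if $\ell\in R(L^*)+R(H^*)$. In this case the system $$L^*\hat z=\ell-H^*Q_2H\hat p,\qquad L\hat p=Q_1^{-1}\hat z$$ has a solution $\hat z\in\mathscr D(L^*)$, $\hat p\in\mathscr D(L)$, and for every solution $(\hat z,\hat p)$ one has $(\ell,\hat p)\ge0$ and $\hat\sigma(\ell)=(\ell,\hat p)^{1/2}$, and the unique minimax a priori estimate is $(\hat u,y)$ with $\hat u=Q_2H\hat p$ (that is, $u=\hat u$ and $c=0$). -/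

import Mathlib

open MeasureTheory
open scoped ENNReal

universe w

namespace MinimaxEstimation

variable {X F Y : Type*}
  [NormedAddCommGroup X] [InnerProductSpace ℝ X]
  [NormedAddCommGroup F] [InnerProductSpace ℝ F]
  [NormedAddCommGroup Y] [InnerProductSpace ℝ Y]

/-- A bounded self-adjoint operator that is positive definite, i.e. bounded below by a positive
multiple of the identity. On a Hilbert space such an operator has a bounded inverse. -/
structure IsPosDef (Q : X →L[ℝ] X) : Prop where
  isSymmetric : ∀ x y, inner ℝ (Q x) y = inner ℝ x (Q y)
  bounded_below : ∃ a : ℝ, 0 < a ∧ ∀ x, a * ‖x‖ ^ 2 ≤ inner ℝ (Q x) x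

/-- The range of `L` and the image under `H` of the kernel of `L` are closed. -/
def ClosedRangeAndKernelImage (L : X →ₗ.[ℝ] F) (H : X →L[ℝ] Y) : Prop :=
  IsClosed (Set.range fun x : L.domain => L x) ∧
    IsClosed ((fun x : L.domain => H x) '' {x | L x = 0})

/-- The set of all pairs `(L x, H x)`, with `x` in the domain of `L`, is closed. -/
def ClosedJointRange (L : X →ₗ.[ℝ] F) (H : X →L[ℝ] Y) : Prop :=
  IsClosed (Set.range fun x : L.domain => (L x, H x))

/-- The noise `η` is a centred square integrable random element of `Y` on the probability space
`(Ω, P)` with `M (Q₂ η, η) ≤ 1`. -/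
structure IsAdmissibleNoise (Q₂ : Y →L[ℝ] Y) {Ω : Type w} [MeasurableSpace Ω] (P : Measure Ω)
    (η : Ω → Y) : Prop where
  isProbabilityMeasure : IsProbabilityMeasure P
  memLp : MemLp η 2 P
  mean_zero : ∫ ω, η ω ∂P = 0
  second_moment_le : ∫ ω, inner ℝ (Q₂ (η ω)) (η ω) ∂P ≤ 1

/-- The worst mean squared distance `sup M (ℓ(φ) - ((u, y) + c))²`, where `y = H φ + η`. The
supremum is over all states `φ` in the domain of `L` with `(Q₁ L φ, L φ) ≤ 1` and over all
admissible noises, on arbitrary probability spaces. -/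
noncomputable def worstMSE (L : X →ₗ.[ℝ] F) (H : X →L[ℝ] Y) (Q₁ : F →L[ℝ] F) (Q₂ : Y →L[ℝ] Y)
    (l : X) (u : Y) (c : ℝ) : ℝ≥0∞ :=
  ⨆ (φ : L.domain) (_ : inner ℝ (Q₁ (L φ)) (L φ) ≤ 1)
    (Ω : Type w) (_ : MeasurableSpace Ω) (P : Measure Ω) (η : Ω → Y)
    (_ : IsAdmissibleNoise Q₂ P η),
    ∫⁻ ω, ENNReal.ofReal ((inner ℝ l (φ : X) - (inner ℝ u (H φ + η ω) + c)) ^ 2) ∂P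

/-- The minimax a priori error: the square root of the infimum, over all affine estimates
`(u, ·) + c`, of the worst mean squared distance. -/
noncomputable def minimaxError (L : X →ₗ.[ℝ] F) (H : X →L[ℝ] Y) (Q₁ : F →L[ℝ] F)
    (Q₂ : Y →L[ℝ] Y) (l : X) : ℝ≥0∞ :=
  (⨅ (u : Y) (c : ℝ), worstMSE.{w} L H Q₁ Q₂ l u c) ^ (1 / 2 : ℝ)

/-- The affine estimate `(u, ·) + c` has the minimal worst mean squared distance. -/
def IsMinimaxEstimate (L : X →ₗ.[ℝ] F) (H : X →L[ℝ] Y) (Q₁ : F →L[ℝ] F) (Q₂ : Y →L[ℝ] Y)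
    (l : X) (u : Y) (c : ℝ) : Prop :=
  ∀ (u' : Y) (c' : ℝ), worstMSE.{w} L H Q₁ Q₂ l u c ≤ worstMSE.{w} L H Q₁ Q₂ l u' c'

/-- `(z, p)` solves the system `L* z = ℓ - H* Q₂ H p`, `L p = Q₁⁻¹ z`. -/
def IsEulerSolution [CompleteSpace X] [CompleteSpace F] [CompleteSpace Y]
    (L : X →ₗ.[ℝ] F) (H : X →L[ℝ] Y) (Q₁ : F →L[ℝ] F) (Q₂ : Y →L[ℝ] Y) (l : X)
    (z : L.adjoint.domain) (p : L.domain) : Prop :=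
  L.adjoint z = l - ContinuousLinearMap.adjoint H (Q₂ (H p)) ∧ L p = Q₁.inverse (z : F)

end MinimaxEstimation

/-!
For a centred noise the mean squared error splits into a squared bias and a variance,
`((l - H* u, φ) - c)² + M (u, η)²`.

*Finiteness.* If the error of some `u` is finite, then by homogeneity `|(l - H* u, φ)| ≤ C ‖L φ‖` on
the domain of `L`, and the Hahn–Banach and Riesz theorems give `l - H* u ∈ R(L*)`
(`mem_range_adjoint_of_le`). This needs no closedness assumption.

*Solvability.* The first closedness assumption implies the second one by the open mapping theorem
(`ClosedRangeAndKernelImage.closedJointRange`). If `{(L x, H x)}` is closed and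
`l = L* z₀ + H* u₀`, then the Lax–Milgram lemma on this closed subspace gives `p` with
`(Q₁ L p, L x) + (Q₂ H p, H x) = (z₀, L x) + (u₀, H x) = (l, x)` for all `x` in the domain of `L`,
which is the weak form of the Euler system with `z = Q₁ L p` (`exists_isEulerSolution`).

*Optimality.* Let `(z, p)` be any solution. The weak form with `x = p` gives
`(l, p) = (Q₁ L p, L p) + (Q₂ H p, H p)`, and by the Cauchy–Schwarz inequalities for `Q₁` and `Q₂`
the estimate `u = Q₂ H p`, `c = 0` has error at most `(l, p)` (`IsEulerSolution.worstMSE_le`).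
Conversely, test the estimate `u = Q₂ (H p + d)`, `c` on a state `± t p` and the two-point noise
proportional to `± (H p + d)`: its error is at least `(l, p) + c² + (Q₂ d, d)`
(`IsEulerSolution.le_worstMSE`). Every `u` has this form, so `(l, p)` is the minimal value, and
it is attained only for `d = 0` and `c = 0`.
-/

namespace MinimaxEstimation

/-! ### Coercive operators -/

section PosDef

variable {G : Type*} [NormedAddCommGroup G] [InnerProductSpace ℝ G]

lemma IsPosDef.inner_nonneg {Q : G →L[ℝ] G} (hQ : IsPosDef Q) (x : G) : 0 ≤ inner ℝ (Q x) x := by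
  obtain ⟨a, ha, h⟩ := hQ.bounded_below
  exact le_trans (by positivity) (h x)

lemma IsPosDef.inner_pos {Q : G →L[ℝ] G} (hQ : IsPosDef Q) {x : G} (hx : x ≠ 0) :
    0 < inner ℝ (Q x) x := by
  obtain ⟨a, ha, h⟩ := hQ.bounded_below
  have := norm_pos_iff.2 hx
  exact lt_of_lt_of_le (by positivity) (h x)

/-- The Cauchy–Schwarz inequality for the inner product `(Q x, y)`. -/
lemma IsPosDef.inner_sq_le {Q : G →L[ℝ] G} (hQ : IsPosDef Q) (x y : G) :
    inner ℝ (Q x) y ^ 2 ≤ inner ℝ (Q x) x * inner ℝ (Q y) y := by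
  have h := discrim_le_zero (a := inner ℝ (Q y) y) (b := 2 * inner ℝ (Q x) y)
    (c := inner ℝ (Q x) x) fun t => by
      have h0 := hQ.inner_nonneg (x + t • y)
      have hs : inner ℝ (Q y) x = inner ℝ (Q x) y := by
        rw [hQ.isSymmetric, real_inner_comm]
      simp only [map_add, map_smul, inner_add_left, inner_add_right, inner_smul_left,
        inner_smul_right, hs, RCLike.conj_to_real] at h0
      linarith
  rw [discrim] at h
  linarith

/-- An operator that is bounded below in the sense of quadratic forms is invertible (the
Lax–Milgram lemma). -/
lemma isUnit_of_coercive [CompleteSpace G] {Q : G →L[ℝ] G} {a : ℝ} (ha : 0 < a)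
    (h : ∀ x, a * ‖x‖ ^ 2 ≤ inner ℝ (Q x) x) : IsUnit Q :=
  Q.isUnit_of_forall_le_norm_inner_map (c := ⟨a, ha.le⟩) ha fun x => by
    rw [mul_comm]
    exact (h x).trans (le_abs_self _)

lemma IsPosDef.exists_equiv [CompleteSpace G] {Q : G →L[ℝ] G} (hQ : IsPosDef Q) :
    ∃ e : G ≃L[ℝ] G, (e : G →L[ℝ] G) = Q := by
  obtain ⟨a, ha, h⟩ := hQ.bounded_below
  obtain ⟨e, he⟩ := isUnit_of_coercive ha h
  exact ⟨ContinuousLinearEquiv.ofUnit e, he⟩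

lemma IsPosDef.inverse_apply_eq_iff [CompleteSpace G] {Q : G →L[ℝ] G} (hQ : IsPosDef Q)
    {x y : G} : x = Q.inverse y ↔ Q x = y := by
  obtain ⟨e, rfl⟩ := hQ.exists_equiv
  rw [ContinuousLinearMap.inverse_equiv]
  exact e.eq_symm_apply

/-- A Galerkin form of the Lax–Milgram lemma: on a closed subspace `K`, the equation `Q k = g`
tested against `K` is solvable in `K`, since the compression of `Q` to `K` is still coercive. -/
lemma exists_mem_inner_eq_of_coercive [CompleteSpace G] {Q : G →L[ℝ] G} {a : ℝ} (ha : 0 < a)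
    (h : ∀ x, a * ‖x‖ ^ 2 ≤ inner ℝ (Q x) x) {K : Submodule ℝ G} (hK : IsClosed (K : Set G))
    (g : G) : ∃ k ∈ K, ∀ k' ∈ K, inner ℝ (Q k) k' = inner ℝ g k' := by
  have : CompleteSpace K := hK.completeSpace_coe
  have hu : IsUnit (K.orthogonalProjectionOnto ∘L Q ∘L K.subtypeL) :=
    isUnit_of_coercive ha fun x => (h x).trans_eq
      (Submodule.inner_orthogonalProjectionOnto_eq_of_mem_right x (Q x)).symm
  obtain ⟨e, he⟩ := hu
  obtain ⟨k, hk⟩ := (ContinuousLinearEquiv.ofUnit e).surjective (K.orthogonalProjectionOnto g)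
  have hk' : K.orthogonalProjectionOnto (Q k) = K.orthogonalProjectionOnto g := by
    rw [← hk]
    exact (DFunLike.congr_fun he k).symm
  refine ⟨k, k.2, fun k' hk'' => ?_⟩
  have hp : ∀ v : G, inner ℝ (K.orthogonalProjectionOnto v : G) k' = inner ℝ v k' :=
    Submodule.inner_orthogonalProjectionOnto_eq_of_mem_right ⟨k', hk''⟩
  rw [← hp, hk', hp]

end PosDef

variable {X F Y : Type*}
  [NormedAddCommGroup X] [InnerProductSpace ℝ X]
  [NormedAddCommGroup F] [InnerProductSpace ℝ F]
  [NormedAddCommGroup Y] [InnerProductSpace ℝ Y]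

/-! ### Closedness of the joint range -/

/-- If `R(L)` is closed, the open mapping theorem gives preimages under `L` with norm control, so
a limit of `(L xₙ, H xₙ)` can be corrected by a null sequence to a limit in `H(N(L))`. -/
lemma ClosedRangeAndKernelImage.closedJointRange [CompleteSpace X] [CompleteSpace F]
    {L : X →ₗ.[ℝ] F} (hL : L.IsClosed) {H : X →L[ℝ] Y}
    (h : ClosedRangeAndKernelImage L H) : ClosedJointRange L H := by
  obtain ⟨hR, hN⟩ := h
  have : CompleteSpace L.graph := IsClosed.completeSpace_coe (hs := hL)
  have hR' : IsClosed (LinearMap.range L.toFun : Set F) := hR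
  have : CompleteSpace (LinearMap.range L.toFun) := hR'.completeSpace_coe
  let T : L.graph →L[ℝ] LinearMap.range L.toFun :=
    ((ContinuousLinearMap.snd ℝ X F) ∘L L.graph.subtypeL).codRestrict _ fun x => by
      obtain ⟨y, -, hy⟩ := L.mem_graph_iff.1 x.2
      exact ⟨y, hy⟩
  have hT : Function.Surjective T := by
    rintro ⟨_, x, rfl⟩
    exact ⟨⟨(x, L x), L.mem_graph x⟩, rfl⟩
  obtain ⟨C, hC, hpre⟩ := T.exists_preimage_norm_le hT
  have hlift : ∀ y : L.domain, ∃ x : L.domain, L x = L y ∧ ‖(x : X)‖ ≤ C * ‖L y‖ := by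
    intro y
    obtain ⟨⟨⟨x₁, x₂⟩, hx⟩, h1, h2⟩ := hpre ⟨L y, y, rfl⟩
    obtain ⟨x, rfl, hx'⟩ := L.mem_graph_iff.1 hx
    refine ⟨x, hx'.trans (congrArg Subtype.val h1), le_trans ?_ h2⟩
    exact le_max_left ‖(x : X)‖ ‖x₂‖
  refine IsSeqClosed.isClosed fun s q hs hq => ?_
  choose x hx using hs
  obtain rfl : s = fun n => (L (x n), H (x n)) := funext fun n => (hx n).symm
  have hq1 : Filter.Tendsto (fun n => L (x n)) Filter.atTop (nhds q.1) :=
    (continuous_fst.tendsto q).comp hq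
  have hq2 : Filter.Tendsto (fun n => H (x n)) Filter.atTop (nhds q.2) :=
    (continuous_snd.tendsto q).comp hq
  obtain ⟨x₀, hx₀⟩ := hR.mem_of_tendsto hq1 (Filter.Eventually.of_forall fun n => ⟨x n, rfl⟩)
  choose w hw hwC using fun n => hlift (x n - x₀)
  have hw0 : Filter.Tendsto (fun n => (w n : X)) Filter.atTop (nhds 0) := by
    refine squeeze_zero_norm hwC ?_
    have h0 : Filter.Tendsto (fun n => L (x n - x₀)) Filter.atTop (nhds 0) := by
      have := hq1.sub_const (L x₀)
      simp only [hx₀, sub_self] at this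
      simpa [LinearPMap.map_sub, hx₀] using this
    simpa using h0.norm.const_mul C
  have hlim : Filter.Tendsto (fun n => H ((x n - x₀ - w n : L.domain) : X)) Filter.atTop
      (nhds (q.2 - H x₀)) := by
    have hHw := (H.continuous.tendsto 0).comp hw0
    simpa using (hq2.sub_const (H x₀)).sub hHw
  obtain ⟨k, hk, hk'⟩ := hN.mem_of_tendsto hlim (Filter.Eventually.of_forall fun n =>
    ⟨x n - x₀ - w n, by simp [LinearPMap.map_sub, hw], rfl⟩)
  refine ⟨x₀ + k, Prod.ext ?_ ?_⟩
  · have hk : L k = 0 := hk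
    simpa [LinearPMap.map_add, hk] using hx₀
  · have hk' : H k = q.2 - H x₀ := hk'
    simp [hk']

/-! ### The range of the adjoint and solvability of the Euler system -/

section Adjoint

variable [CompleteSpace X] {L : X →ₗ.[ℝ] F}

lemma inner_adjoint (hL : Dense (L.domain : Set X)) (z : L.adjoint.domain) (x : L.domain) :
    inner ℝ (L.adjoint z) (x : X) = inner ℝ (z : F) (L x) :=
  L.adjoint_isFormalAdjoint hL z x

/-- A vector `v` is in `R(L*)` as soon as `(v, ·)` is bounded with respect to `‖L ·‖`: the
functional `L x ↦ (v, x)` extends from `R(L)` to `F` by Hahn–Banach, and the vector representing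
the extension is mapped to `v` by `L*`. No closedness of `R(L)` is needed. -/
lemma mem_range_adjoint_of_le [CompleteSpace F] (hL : Dense (L.domain : Set X)) {v : X} {C : ℝ}
    (h : ∀ x : L.domain, |inner ℝ v (x : X)| ≤ C * ‖L x‖) :
    v ∈ LinearMap.range L.adjoint.toFun := by
  obtain ⟨g, hg⟩ := L.toFun.rangeRestrict.exists_rightInverse_of_surjective
    (LinearMap.range_rangeRestrict _)
  have hLg : ∀ y, L (g y) = y := fun y => congrArg Subtype.val (DFunLike.congr_fun hg y)
  let f : StrongDual ℝ (LinearMap.range L.toFun) :=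
    ((innerₗ X v) ∘ₗ L.domain.subtype ∘ₗ g).mkContinuous C fun y => by
      have := h (g y)
      rw [hLg] at this
      simpa using this
  obtain ⟨f', hf', -⟩ := exists_extension_norm_eq _ f
  have key : ∀ x : L.domain, inner ℝ v (x : X) =
      inner ℝ ((InnerProductSpace.toDual ℝ F).symm f') (L x) := by
    intro x
    rw [InnerProductSpace.toDual_symm_apply]
    have h1 : f' (L x) = inner ℝ v (g ⟨L x, x, rfl⟩ : X) := hf' ⟨L x, x, rfl⟩
    have h2 := h (x - g ⟨L x, x, rfl⟩)
    rw [LinearPMap.map_sub, hLg, sub_self, norm_zero, mul_zero] at h2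
    have h3 := abs_nonpos_iff.1 h2
    rw [Submodule.coe_sub, inner_sub_right] at h3
    rw [h1]
    linarith
  have hz := L.mem_adjoint_domain_of_exists _ ⟨v, key⟩
  exact ⟨⟨_, hz⟩, L.adjoint_apply_eq hL ⟨_, hz⟩ key⟩

/-- Solvability of the Euler system: for `l = L* z₀ + H* u₀`, the pair `(L p, H p)` is the
projection of `(Q₁⁻¹ z₀, Q₂⁻¹ u₀)` onto the closed subspace `{(L x, H x)}` in the metric given by
`Q₁` and `Q₂`. -/
lemma exists_isEulerSolution [CompleteSpace F] [CompleteSpace Y] (hL : Dense (L.domain : Set X))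
    {H : X →L[ℝ] Y} {Q₁ : F →L[ℝ] F} (hQ₁ : IsPosDef Q₁) {Q₂ : Y →L[ℝ] Y} (hQ₂ : IsPosDef Q₂)
    (hc : ClosedJointRange L H) {l : X}
    (hl : l ∈ LinearMap.range L.adjoint.toFun ⊔
        LinearMap.range (ContinuousLinearMap.adjoint H : Y →ₗ[ℝ] X)) :
    ∃ (z : L.adjoint.domain) (p : L.domain), IsEulerSolution L H Q₁ Q₂ l z p := by
  obtain ⟨_, ⟨z₀, rfl⟩, _, ⟨u₀, rfl⟩, rfl⟩ := Submodule.mem_sup.1 hl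
  let e := WithLp.prodContinuousLinearEquiv 2 ℝ F Y
  let Q : WithLp 2 (F × Y) →L[ℝ] WithLp 2 (F × Y) :=
    (e.symm : F × Y →L[ℝ] WithLp 2 (F × Y)) ∘L (Q₁.prodMap Q₂) ∘L
      (e : WithLp 2 (F × Y) →L[ℝ] F × Y)
  obtain ⟨a₁, ha₁, h₁⟩ := hQ₁.bounded_below
  obtain ⟨a₂, ha₂, h₂⟩ := hQ₂.bounded_below
  have hQ : ∀ x, min a₁ a₂ * ‖x‖ ^ 2 ≤ inner ℝ (Q x) x := by
    intro x
    rw [WithLp.prod_norm_sq_eq_of_L2, WithLp.prod_inner_apply, mul_add]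
    refine add_le_add (le_trans ?_ (h₁ x.fst)) (le_trans ?_ (h₂ x.snd))
    · exact mul_le_mul_of_nonneg_right (min_le_left _ _) (sq_nonneg _)
    · exact mul_le_mul_of_nonneg_right (min_le_right _ _) (sq_nonneg _)
  let T : L.domain →ₗ[ℝ] F × Y := L.toFun.prod ((H : X →ₗ[ℝ] Y) ∘ₗ L.domain.subtype)
  let K : Submodule ℝ (WithLp 2 (F × Y)) :=
    (LinearMap.range T).comap (e : WithLp 2 (F × Y) →ₗ[ℝ] F × Y)
  have hK : IsClosed (K : Set (WithLp 2 (F × Y))) := by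
    have hT : IsClosed (LinearMap.range T : Set (F × Y)) := hc
    exact hT.preimage e.continuous
  obtain ⟨k, ⟨p, hp⟩, hk⟩ := exists_mem_inner_eq_of_coercive (lt_min ha₁ ha₂) hQ hK
    (e.symm ((z₀ : F), u₀))
  obtain rfl : k = e.symm (L p, H p) := e.eq_symm_apply.2 hp.symm
  have key : ∀ x : L.domain, inner ℝ (Q₁ (L p)) (L x) + inner ℝ (Q₂ (H p)) (H x) =
      inner ℝ (z₀ : F) (L x) + inner ℝ u₀ (H x) := fun x => hk (e.symm (L x, H x)) ⟨x, rfl⟩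
  have hz : ∀ x : L.domain, inner ℝ (L.adjoint z₀ + ContinuousLinearMap.adjoint H u₀ -
      ContinuousLinearMap.adjoint H (Q₂ (H p))) (x : X) = inner ℝ (Q₁ (L p)) (L x) := by
    intro x
    have := key x
    rw [inner_sub_left, inner_add_left, inner_adjoint hL, ContinuousLinearMap.adjoint_inner_left,
      ContinuousLinearMap.adjoint_inner_left]
    linarith
  have hmem := L.mem_adjoint_domain_of_exists _ ⟨_, hz⟩
  exact ⟨⟨_, hmem⟩, p, L.adjoint_apply_eq hL ⟨_, hmem⟩ hz, hQ₁.inverse_apply_eq_iff.2 rfl⟩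

end Adjoint

/-! ### Bounds for the worst mean squared error -/

section WorstCase

lemma integral_half_dirac_add_dirac {Ω E : Type*} [MeasurableSpace Ω] [DiscreteMeasurableSpace Ω]
    [Finite Ω] [NormedAddCommGroup E] [NormedSpace ℝ E] [CompleteSpace E] (f : Ω → E) (a b : Ω) :
    ∫ ω, f ω ∂((2⁻¹ : ℝ≥0∞) • (Measure.dirac a + Measure.dirac b)) =
      (2⁻¹ : ℝ) • (f a + f b) := by
  rw [integral_smul_measure, integral_add_measure .of_finite .of_finite, integral_dirac,
    integral_dirac]
  simp

/-- The two-point noise `± y` with equal probabilities, which turns the mean squared error into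
`a² + (u, y)²`. It lives on `ULift Bool` in order to be available in every universe. -/
lemma le_worstMSE {L : X →ₗ.[ℝ] F} {H : X →L[ℝ] Y} {Q₁ : F →L[ℝ] F} {Q₂ : Y →L[ℝ] Y} {l : X}
    {u : Y} {c : ℝ} {φ : L.domain} (hφ : inner ℝ (Q₁ (L φ)) (L φ) ≤ 1) {y : Y}
    (hy : inner ℝ (Q₂ y) y ≤ 1) :
    ENNReal.ofReal ((inner ℝ l (φ : X) - inner ℝ u (H φ) - c) ^ 2 + inner ℝ u y ^ 2) ≤
      worstMSE.{w} L H Q₁ Q₂ l u c := by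
  let _ : MeasurableSpace (ULift.{w} Bool) := ⊤
  have : DiscreteMeasurableSpace (ULift.{w} Bool) := ⟨fun _ => trivial⟩
  let P : Measure (ULift.{w} Bool) :=
    (2⁻¹ : ℝ≥0∞) • (Measure.dirac ⟨true⟩ + Measure.dirac ⟨false⟩)
  let η : ULift.{w} Bool → Y := fun ω => if ω.down then y else -y
  have hP : IsProbabilityMeasure P := ⟨by
    simp [P, ENNReal.inv_two_add_inv_two]⟩
  have hη : IsAdmissibleNoise Q₂ P η := by
    refine ⟨hP, .of_discrete, ?_, ?_⟩
    · by_cases hY : CompleteSpace Y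
      · rw [integral_half_dirac_add_dirac]; simp [η]
      · exact integral_of_not_completeSpace hY
    · rw [integral_half_dirac_add_dirac]
      simp only [η, if_true, Bool.false_eq_true, if_false, map_neg, inner_neg_neg, smul_eq_mul]
      linarith
  refine le_trans (le_of_eq ?_) (le_iSup_of_le φ <| le_iSup_of_le hφ <|
    le_iSup_of_le (ULift.{w} Bool) <| le_iSup_of_le _ <| le_iSup_of_le P <| le_iSup_of_le η <|
    le_iSup_of_le hη le_rfl)
  rw [← ofReal_integral_eq_lintegral_ofReal .of_finite
    (Filter.Eventually.of_forall fun _ => sq_nonneg _), integral_half_dirac_add_dirac]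
  congr 1
  simp only [η, if_true, Bool.false_eq_true, if_false, inner_add_right, inner_neg_right,
    smul_eq_mul]
  ring

/-- For `u = Q₂ e` the worst noise is the two-point noise in the direction `e`, so it contributes
`(Q₂ e, e)` to the worst mean squared error. -/
lemma le_worstMSE_of_apply {L : X →ₗ.[ℝ] F} {H : X →L[ℝ] Y} {Q₁ : F →L[ℝ] F} {Q₂ : Y →L[ℝ] Y}
    (hQ₂ : IsPosDef Q₂) {l : X} {e : Y} {c : ℝ} {φ : L.domain}
    (hφ : inner ℝ (Q₁ (L φ)) (L φ) ≤ 1) :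
    ENNReal.ofReal ((inner ℝ l (φ : X) - inner ℝ (Q₂ e) (H φ) - c) ^ 2 + inner ℝ (Q₂ e) e) ≤
      worstMSE.{w} L H Q₁ Q₂ l (Q₂ e) c := by
  have h0 := hQ₂.inner_nonneg e
  set q := inner ℝ (Q₂ e) e with hq
  -- For `q = 0` the junk value `0⁻¹ = 0` yields the zero noise, which is then optimal.
  have hs : (Real.sqrt q)⁻¹ ^ 2 = q⁻¹ := by rw [inv_pow, Real.sq_sqrt h0]
  have hy : inner ℝ (Q₂ ((Real.sqrt q)⁻¹ • e)) ((Real.sqrt q)⁻¹ • e) ≤ 1 := by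
    rw [map_smul, inner_smul_left, inner_smul_right, RCLike.conj_to_real, ← hq, ← mul_assoc,
      ← sq, hs]
    exact inv_mul_le_one
  refine le_trans (le_of_eq ?_) (le_worstMSE hφ hy)
  rw [inner_smul_right, mul_pow, hs, ← hq]
  congr 2
  rcases eq_or_ne q 0 with h | h
  · simp [h]
  · field_simp

/-- The state set is symmetric, so one of `± φ` makes the shift `c` add its square to the
error. -/
lemma le_worstMSE_add_sq {L : X →ₗ.[ℝ] F} {H : X →L[ℝ] Y} {Q₁ : F →L[ℝ] F} {Q₂ : Y →L[ℝ] Y}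
    (hQ₂ : IsPosDef Q₂) {l : X} {e : Y} {c : ℝ} {φ : L.domain}
    (hφ : inner ℝ (Q₁ (L φ)) (L φ) ≤ 1) :
    ENNReal.ofReal ((inner ℝ l (φ : X) - inner ℝ (Q₂ e) (H φ)) ^ 2 + c ^ 2 +
      inner ℝ (Q₂ e) e) ≤ worstMSE.{w} L H Q₁ Q₂ l (Q₂ e) c := by
  set x := inner ℝ l (φ : X) - inner ℝ (Q₂ e) (H φ) with hx
  rcases le_total (x * c) 0 with h | h
  · refine le_trans (ENNReal.ofReal_le_ofReal ?_) (le_worstMSE_of_apply hQ₂ hφ)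
    rw [← hx]
    nlinarith
  · have hφ' : inner ℝ (Q₁ (L (-φ))) (L (-φ)) ≤ 1 := by
      simpa [LinearPMap.map_neg] using hφ
    refine le_trans (ENNReal.ofReal_le_ofReal ?_) (le_worstMSE_of_apply hQ₂ hφ')
    have : inner ℝ l ((-φ : L.domain) : X) - inner ℝ (Q₂ e) (H (-φ : L.domain)) = -x := by
      simp only [Submodule.coe_neg, map_neg, inner_neg_right, hx]
      ring
    rw [this]
    nlinarith

/-- The mean squared error is the sum of the squared bias and the variance of `(u, η)`. -/
lemma worstMSE_le [CompleteSpace Y] {L : X →ₗ.[ℝ] F} {H : X →L[ℝ] Y} {Q₁ : F →L[ℝ] F}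
    {Q₂ : Y →L[ℝ] Y} (hQ₂ : IsPosDef Q₂) {l : X} {e : Y} {A : ℝ}
    (hA : ∀ φ : L.domain, inner ℝ (Q₁ (L φ)) (L φ) ≤ 1 →
      (inner ℝ l (φ : X) - inner ℝ (Q₂ e) (H φ)) ^ 2 ≤ A) :
    worstMSE.{w} L H Q₁ Q₂ l (Q₂ e) 0 ≤ ENNReal.ofReal (A + inner ℝ (Q₂ e) e) := by
  refine iSup_le fun φ => iSup_le fun hφ => iSup_le fun Ω => iSup_le fun _ => iSup_le fun P =>
    iSup_le fun η => iSup_le fun hη => ?_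
  have := hη.isProbabilityMeasure
  set x := inner ℝ l (φ : X) - inner ℝ (Q₂ e) (H φ) with hx
  have hi : Integrable η P := hη.memLp.integrable one_le_two
  have h1 : Integrable (fun ω => inner ℝ (Q₂ e) (η ω)) P := hi.const_inner _
  have h2 : Integrable (fun ω => inner ℝ (Q₂ e) (η ω) ^ 2) P :=
    (hη.memLp.const_inner (Q₂ e)).integrable_sq
  have h3 : Integrable (fun ω => inner ℝ (Q₂ (η ω)) (η ω)) P := by
    refine (((memLp_two_iff_integrable_sq_norm hη.memLp.1).1 hη.memLp).const_mul ‖Q₂‖).mono'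
      ((Q₂.continuous.comp_aestronglyMeasurable hη.memLp.1).inner hη.memLp.1)
      (Filter.Eventually.of_forall fun ω => (norm_inner_le_norm _ _).trans ?_)
    rw [sq, ← mul_assoc]
    exact mul_le_mul_of_nonneg_right (Q₂.le_opNorm _) (norm_nonneg _)
  have hexp : (fun ω => (inner ℝ l (φ : X) - (inner ℝ (Q₂ e) (H φ + η ω) + 0)) ^ 2) =
      fun ω => (x ^ 2 - 2 * x * inner ℝ (Q₂ e) (η ω)) + inner ℝ (Q₂ e) (η ω) ^ 2 := by
    funext ω
    rw [hx, inner_add_right]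
    ring
  have hint1 : Integrable (fun ω => x ^ 2 - 2 * x * inner ℝ (Q₂ e) (η ω)) P :=
    (integrable_const _).sub (h1.const_mul _)
  rw [← ofReal_integral_eq_lintegral_ofReal (by rw [hexp]; exact hint1.add h2)
    (Filter.Eventually.of_forall fun _ => sq_nonneg _)]
  refine ENNReal.ofReal_le_ofReal ?_
  have hvar : ∫ ω, inner ℝ (Q₂ e) (η ω) ^ 2 ∂P ≤ inner ℝ (Q₂ e) e := by
    calc ∫ ω, inner ℝ (Q₂ e) (η ω) ^ 2 ∂P
        ≤ ∫ ω, inner ℝ (Q₂ e) e * inner ℝ (Q₂ (η ω)) (η ω) ∂P :=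
          integral_mono h2 (h3.const_mul _) fun ω => hQ₂.inner_sq_le e (η ω)
      _ = inner ℝ (Q₂ e) e * ∫ ω, inner ℝ (Q₂ (η ω)) (η ω) ∂P := integral_const_mul _ _
      _ ≤ inner ℝ (Q₂ e) e :=
          mul_le_of_le_one_right (hQ₂.inner_nonneg e) hη.second_moment_le
  rw [hexp, integral_add hint1 h2, integral_sub (integrable_const _) (h1.const_mul _),
    integral_const_mul, integral_inner hi, hη.mean_zero]
  simpa using add_le_add (hA φ hφ) hvar

/-- If some estimate has finite worst error, then `l - H* u` is bounded on the states with
`(Q₁ L φ, L φ) ≤ 1`, and by homogeneity it is bounded with respect to `‖L ·‖`. -/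
lemma exists_abs_inner_le_of_worstMSE_lt_top {L : X →ₗ.[ℝ] F} {H : X →L[ℝ] Y} {Q₁ : F →L[ℝ] F}
    {Q₂ : Y →L[ℝ] Y} {l : X} {u : Y} {c : ℝ} (h : worstMSE.{w} L H Q₁ Q₂ l u c < ⊤) :
    ∃ C : ℝ, ∀ x : L.domain, |inner ℝ l (x : X) - inner ℝ u (H x)| ≤ C * ‖L x‖ := by
  set S := (worstMSE.{w} L H Q₁ Q₂ l u c).toReal with hS
  have hb : ∀ x : L.domain, ‖Q₁‖ * ‖L x‖ ^ 2 ≤ 1 →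
      |inner ℝ l (x : X) - inner ℝ u (H x)| ≤ Real.sqrt S + |c| := by
    intro x hx
    have hx' : inner ℝ (Q₁ (L x)) (L x) ≤ 1 := by
      refine le_trans (real_inner_le_norm _ _) (le_trans ?_ hx)
      rw [sq, ← mul_assoc]
      exact mul_le_mul_of_nonneg_right (Q₁.le_opNorm _) (norm_nonneg _)
    have h1 := (ENNReal.ofReal_le_iff_le_toReal h.ne).1
      (le_worstMSE.{w} (H := H) (Q₂ := Q₂) (l := l) (u := u) (c := c) (y := 0) hx' (by simp))
    rw [inner_zero_right, zero_pow two_ne_zero, add_zero] at h1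
    have h2 := Real.abs_le_sqrt h1
    have h3 := abs_add_le (inner ℝ l (x : X) - inner ℝ u (H x) - c) c
    rw [sub_add_cancel] at h3
    linarith
  set M := Real.sqrt S + |c|
  have hM : 0 ≤ M := by positivity
  set r := Real.sqrt (‖Q₁‖ + 1)
  have hr : r ^ 2 = ‖Q₁‖ + 1 := Real.sq_sqrt (by positivity)
  have hr0 : 0 < r := Real.sqrt_pos.2 (by positivity)
  refine ⟨M * r, fun x => ?_⟩
  have hscale : ∀ t : ℝ, 0 < t → t * (r * ‖L x‖) ≤ 1 →
      t * |inner ℝ l (x : X) - inner ℝ u (H x)| ≤ M := by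
    intro t ht h1
    have h2 := hb (t • x) (by
      rw [LinearPMap.map_smul, norm_smul, Real.norm_of_nonneg ht.le]
      have h3 : (t * (r * ‖L x‖)) ^ 2 ≤ 1 := pow_le_one₀ (by positivity) h1
      have h4 : (t * (r * ‖L x‖)) ^ 2 = (‖Q₁‖ + 1) * (t * ‖L x‖) ^ 2 := by rw [← hr]; ring
      nlinarith [sq_nonneg (t * ‖L x‖)])
    rwa [Submodule.coe_smul, map_smul, inner_smul_right, inner_smul_right, ← mul_sub, abs_mul,
      abs_of_pos ht] at h2
  rcases (norm_nonneg (L x)).eq_or_lt with h0 | h0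
  · -- On `N(L)` every multiple of `x` is admissible, so the functional vanishes there.
    rw [← h0, mul_zero]
    by_contra! hpos
    have := hscale ((M + 1) / |inner ℝ l (x : X) - inner ℝ u (H x)|) (by positivity)
      (by rw [← h0]; simp)
    rw [div_mul_cancel₀ _ hpos.ne'] at this
    linarith
  · have hp : 0 < r * ‖L x‖ := by positivity
    have := hscale (r * ‖L x‖)⁻¹ (by positivity) (inv_mul_cancel₀ hp.ne').le
    rw [inv_mul_le_iff₀ hp] at this
    linarith

end WorstCase

/-! ### Optimality of the Euler solution -/

section EulerSolution

variable [CompleteSpace X] [CompleteSpace F] [CompleteSpace Y] {L : X →ₗ.[ℝ] F} {H : X →L[ℝ] Y}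
  {Q₁ : F →L[ℝ] F} {Q₂ : Y →L[ℝ] Y} {l : X} {z : L.adjoint.domain} {p : L.domain}

/-- The weak form of the Euler system. -/
lemma IsEulerSolution.inner_eq (h : IsEulerSolution L H Q₁ Q₂ l z p)
    (hL : Dense (L.domain : Set X)) (hQ₁ : IsPosDef Q₁) (x : L.domain) :
    inner ℝ l (x : X) = inner ℝ (Q₁ (L p)) (L x) + inner ℝ (Q₂ (H p)) (H x) := by
  have h1 := inner_adjoint hL z x
  rw [h.1, ← hQ₁.inverse_apply_eq_iff.1 h.2, inner_sub_left,
    ContinuousLinearMap.adjoint_inner_left] at h1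
  linarith

lemma IsEulerSolution.inner_nonneg (h : IsEulerSolution L H Q₁ Q₂ l z p)
    (hL : Dense (L.domain : Set X)) (hQ₁ : IsPosDef Q₁) (hQ₂ : IsPosDef Q₂) :
    0 ≤ inner ℝ l (p : X) := by
  rw [h.inner_eq hL hQ₁]
  exact add_nonneg (hQ₁.inner_nonneg _) (hQ₂.inner_nonneg _)

/-- Cauchy–Schwarz for `Q₁` and for `Q₂` bounds the error of the estimate `Q₂ H p`. -/
lemma IsEulerSolution.worstMSE_le (h : IsEulerSolution L H Q₁ Q₂ l z p)
    (hL : Dense (L.domain : Set X)) (hQ₁ : IsPosDef Q₁) (hQ₂ : IsPosDef Q₂) :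
    worstMSE.{w} L H Q₁ Q₂ l (Q₂ (H p)) 0 ≤ ENNReal.ofReal (inner ℝ l (p : X)) := by
  rw [h.inner_eq hL hQ₁]
  refine MinimaxEstimation.worstMSE_le hQ₂ fun φ hφ => ?_
  rw [h.inner_eq hL hQ₁, add_sub_cancel_right]
  exact (hQ₁.inner_sq_le _ _).trans (mul_le_of_le_one_right (hQ₁.inner_nonneg _) hφ)

/-- The estimate `(Q₂ (H p + d), ·) + c` is worse than `(Q₂ H p, ·)` by at least `c² + (Q₂ d, d)`,
already on the states proportional to `p`. -/
lemma IsEulerSolution.le_worstMSE (h : IsEulerSolution L H Q₁ Q₂ l z p)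
    (hL : Dense (L.domain : Set X)) (hQ₁ : IsPosDef Q₁) (hQ₂ : IsPosDef Q₂) (d : Y) (c : ℝ) :
    ENNReal.ofReal (inner ℝ l (p : X) + c ^ 2 + inner ℝ (Q₂ d) d) ≤
      worstMSE.{w} L H Q₁ Q₂ l (Q₂ (H p + d)) c := by
  have hp := h.inner_eq hL hQ₁ p
  have hA := hQ₁.inner_nonneg (L p)
  set A := inner ℝ (Q₁ (L p)) (L p) with hAdef
  set m := inner ℝ (Q₂ d) (H p) with hm
  -- `t p` is the normalized state for `A > 0`; for `A = 0` every multiple of `p` is admissible.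
  obtain ⟨t, ht1, ht2⟩ : ∃ t : ℝ, t ^ 2 * A ≤ 1 ∧ A - 2 * m ≤ t ^ 2 * (A - m) ^ 2 := by
    rcases hA.eq_or_lt with h0 | h0
    · rcases eq_or_ne m 0 with h1 | h1
      · exact ⟨0, by simp, by simp [← h0, h1]⟩
      · have hpos := abs_pos.2 h1
        refine ⟨Real.sqrt (2 / |m|), by simp [← h0], ?_⟩
        rw [Real.sq_sqrt (by positivity), ← h0, zero_sub, zero_sub, neg_sq, ← sq_abs m]
        have : 2 / |m| * |m| ^ 2 = 2 * |m| := by field_simp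
        rw [this]
        linarith [neg_abs_le m]
    · refine ⟨(Real.sqrt A)⁻¹, ?_, ?_⟩ <;> rw [inv_pow, Real.sq_sqrt hA]
      · exact inv_mul_le_one
      · rw [le_inv_mul_iff₀ h0]
        nlinarith [sq_nonneg m]
  have hφ : inner ℝ (Q₁ (L (t • p))) (L (t • p)) ≤ 1 := by
    rw [LinearPMap.map_smul, map_smul, inner_smul_left, inner_smul_right, RCLike.conj_to_real,
      ← hAdef]
    linarith
  refine le_trans (ENNReal.ofReal_le_ofReal ?_) (le_worstMSE_add_sq hQ₂ hφ)
  have hs : inner ℝ (Q₂ (H p)) d = m := by rw [hQ₂.isSymmetric, real_inner_comm]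
  have h1 : inner ℝ l ((t • p : L.domain) : X) - inner ℝ (Q₂ (H p + d)) (H (t • p : L.domain)) =
      t * (A - m) := by
    rw [Submodule.coe_smul, map_smul, inner_smul_right, inner_smul_right, hp, map_add,
      inner_add_left]
    ring
  rw [h1, mul_pow, hp]
  simp only [map_add, inner_add_left, inner_add_right, hs, ← hm]
  linarith

end EulerSolution

end MinimaxEstimation

/-! ### The minimax a priori estimate -/

theorem theorem1 {X F Y : Type*}
    [NormedAddCommGroup X] [InnerProductSpace ℝ X] [CompleteSpace X]
    [NormedAddCommGroup F] [InnerProductSpace ℝ F] [CompleteSpace F]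
    [NormedAddCommGroup Y] [InnerProductSpace ℝ Y] [CompleteSpace Y]
    (L : X →ₗ.[ℝ] F) (hLdense : Dense (L.domain : Set X)) (hLclosed : L.IsClosed)
    (H : X →L[ℝ] Y)
    (Q₁ : F →L[ℝ] F) (hQ₁ : MinimaxEstimation.IsPosDef Q₁)
    (Q₂ : Y →L[ℝ] Y) (hQ₂ : MinimaxEstimation.IsPosDef Q₂)
    (hclosed : MinimaxEstimation.ClosedRangeAndKernelImage L H ∨
      MinimaxEstimation.ClosedJointRange L H)
    (l : X) :
    (MinimaxEstimation.minimaxError.{w} L H Q₁ Q₂ l < ⊤ ↔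
      l ∈ LinearMap.range L.adjoint.toFun ⊔
        LinearMap.range (ContinuousLinearMap.adjoint H : Y →ₗ[ℝ] X)) ∧
    (l ∈ LinearMap.range L.adjoint.toFun ⊔
        LinearMap.range (ContinuousLinearMap.adjoint H : Y →ₗ[ℝ] X) →
      (∃ (z : L.adjoint.domain) (p : L.domain),
        MinimaxEstimation.IsEulerSolution L H Q₁ Q₂ l z p) ∧
      ∀ (z : L.adjoint.domain) (p : L.domain),
        MinimaxEstimation.IsEulerSolution L H Q₁ Q₂ l z p →
          0 ≤ inner ℝ l (p : X) ∧
          MinimaxEstimation.minimaxError.{w} L H Q₁ Q₂ l =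
            ENNReal.ofReal (Real.sqrt (inner ℝ l (p : X))) ∧
          ∀ (u : Y) (c : ℝ),
            MinimaxEstimation.IsMinimaxEstimate.{w} L H Q₁ Q₂ l u c ↔
              u = Q₂ (H p) ∧ c = 0) := by
  open MinimaxEstimation in
  have hjoint : ClosedJointRange L H := hclosed.elim (·.closedJointRange hLclosed) id
  have hsol : ∀ (z : L.adjoint.domain) (p : L.domain), IsEulerSolution L H Q₁ Q₂ l z p →
      0 ≤ inner ℝ l (p : X) ∧
      minimaxError.{w} L H Q₁ Q₂ l = ENNReal.ofReal (Real.sqrt (inner ℝ l (p : X))) ∧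
      ∀ (u : Y) (c : ℝ), IsMinimaxEstimate.{w} L H Q₁ Q₂ l u c ↔ u = Q₂ (H p) ∧ c = 0 := by
    intro z p h
    have h0 := h.inner_nonneg hLdense hQ₁ hQ₂
    have hup := h.worstMSE_le.{w} hLdense hQ₁ hQ₂
    -- Every `u` has the form `Q₂ (H p + d)`, because `Q₂` is onto.
    have hd : ∀ u : Y, ∃ d : Y, u = Q₂ (H p + d) := fun u =>
      ⟨Q₂.inverse u - H p, by rw [add_sub_cancel, hQ₂.inverse_apply_eq_iff.1 rfl]⟩
    have hlow : ∀ (u : Y) (c : ℝ),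
        ENNReal.ofReal (inner ℝ l (p : X)) ≤ worstMSE.{w} L H Q₁ Q₂ l u c := by
      intro u c
      obtain ⟨d, rfl⟩ := hd u
      refine le_trans (ENNReal.ofReal_le_ofReal ?_) (h.le_worstMSE hLdense hQ₁ hQ₂ d c)
      linarith [sq_nonneg c, hQ₂.inner_nonneg d]
    refine ⟨h0, ?_, fun u c => ⟨fun hmin => ?_, ?_⟩⟩
    · have : ⨅ (u : Y) (c : ℝ), worstMSE.{w} L H Q₁ Q₂ l u c =
          ENNReal.ofReal (inner ℝ l (p : X)) :=
        le_antisymm (iInf₂_le_of_le _ _ hup) (le_iInf₂ hlow)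
      rw [minimaxError, this, ENNReal.ofReal_rpow_of_nonneg h0 (by norm_num),
        Real.sqrt_eq_rpow]
    · obtain ⟨d, rfl⟩ := hd u
      have h1 := (h.le_worstMSE.{w} hLdense hQ₁ hQ₂ d c).trans ((hmin _ _).trans hup)
      rw [ENNReal.ofReal_le_ofReal_iff h0] at h1
      have h2 := hQ₂.inner_nonneg d
      have hc : c = 0 := pow_eq_zero_iff two_ne_zero |>.1 (by nlinarith [sq_nonneg c])
      have hd0 : d = 0 := by
        by_contra hne
        have := hQ₂.inner_pos hne
        linarith [sq_nonneg c]
      simp [hc, hd0]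
    · rintro ⟨rfl, rfl⟩ u' c'
      exact hup.trans (hlow u' c')
  refine ⟨⟨fun hfin => ?_, fun hl => ?_⟩,
    fun hl => ⟨exists_isEulerSolution hLdense hQ₁ hQ₂ hjoint hl, hsol⟩⟩
  · have hinf : ⨅ (u : Y) (c : ℝ), worstMSE.{w} L H Q₁ Q₂ l u c < ⊤ :=
      (ENNReal.rpow_lt_top_iff_of_pos (by norm_num)).1 hfin
    obtain ⟨u, hu⟩ := iInf_lt_iff.1 hinf
    obtain ⟨c, hc⟩ := iInf_lt_iff.1 hu
    obtain ⟨C, hC⟩ := exists_abs_inner_le_of_worstMSE_lt_top hc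
    refine Submodule.mem_sup.2 ⟨l - ContinuousLinearMap.adjoint H u, ?_, _, ⟨u, rfl⟩,
      sub_add_cancel _ _⟩
    refine mem_range_adjoint_of_le (C := C) hLdense fun x => ?_
    rw [inner_sub_left, ContinuousLinearMap.adjoint_inner_left]
    exact hC x
  · obtain ⟨z, p, h⟩ := exists_isEulerSolution hLdense hQ₁ hQ₂ hjoint hl
    rw [(hsol z p h).2.1]
    exact ENNReal.ofReal_lt_top
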